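/- Let $d\ge 0$, let $\tau\in\mathbb R^d_{\ge 0}$, and let $[0,\tau]=\prod_j[0,\tau_j]$ and $(a,b]=\prod_j(a_j,b_j]$. A function $F:[0,\tau]\to\mathbb R$ is called cadlag if at every point $x\in[0,\tau]$ the limit of $F(y)$ as $y\to x$ exists within each of the $2^d$ quadrants $\{y\in[0,\tau]: y_j<x_j\ (j\in r),\ y_j\ge x_j\ (j\notin r)\}$, $r\subset\{1,\dots,d\}$, that accumulates at $x$, and $F$ is continuous at $x$ from the quadrant $\{y\ge x\}$. For nonempty $s\subset\{1,\dots,d\}$ let $F_s(u_s)=F(u_s,0_{-s})$ be the section of $F$ in which the coordinates outside $s$ are set to $0$, and let $V(F_s)\in[0,\infty]$ be its Vitali variation on $(0_s,\tau_s]$: the supremum over grids of $(0_s,\tau_s]$ of the sum over the cells of the absolute value of the generalized difference of $F_s$ over the $2^{|s|}$ corners of the cell. The sectional variation norm of $F$ is \[ \|F\|_v^*=|F(0)|+\sum_{\emptyset\ne s\subset\{1,\dots,d\}}V(F_s). \] Let $F,Z$ be cadlag functions on $[0,\tau]$ with $\|F\|_v^*<\infty$ and $\|Z\|_v^*<\infty$.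 Then the following hold. 1. There is a unique finite signed Borel measure $dZ$ on $[0,\tau]$ with $dZ([0,x])=Z(x)$ for all $x\in[0,\tau]$. For every nonempty $s$ there is a unique finite signed Borel measure $dF_s$ on $(0_s,\tau_s]$ that gives each box $(a,b]$ with $0\le a\le b\le\tau_s$ the generalized difference of $F_s$ over the corners of that box, and its total variation is $\int_{(0_s,\tau_s]}|dF_s|=V(F_s)$. 2. With $\bar Z(u)=dZ([u,\tau])$, all integrals below converge absolutely and \[ \int_{[0,\tau]}F(x)\,dZ(x)=F(0)\,\bar Z(0)+\sum_{\emptyset\ne s\subset\{1,\dots,d\}}\int_{(0_s,\tau_s]}\bar Z(u_s,0_{-s})\,dF_s(u_s). \] 3. Consequently, with $\|\bar Z\|_\infty=\sup_{u\in[0,\tau]}|\bar Z(u)|<\infty$, \[ \int_{[0,\tau]}F(x)\,dZ(x)\le\|\bar Z\|_\infty\,\|F\|_v^*. \] -/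

import Mathlib

open MeasureTheory Filter Topology
open scoped ENNReal

noncomputable section

namespace Sectional

variable {ι : Type*} [Fintype ι] [DecidableEq ι]

/-- The part of the cube `[0, τ]` lying in the quadrant at `x` that is approached strictly from
below in the coordinates in `r` and from above (weakly) in the other coordinates. -/
def quadrant (τ x : ι → ℝ) (r : Finset ι) : Set (ι → ℝ) :=
  {y | y ∈ Set.Icc 0 τ ∧ ∀ j, if j ∈ r then y j < x j else x j ≤ y j}

/-- Multivariate cadlag functions on the cube `[0, τ]`: at every point the limit from each of the
quadrants exists, and the function is continuous from the upper right quadrant. Values outside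
the cube are irrelevant. -/
def IsCadlag (τ : ι → ℝ) (F : (ι → ℝ) → ℝ) : Prop :=
  ∀ x ∈ Set.Icc 0 τ,
    (∀ r : Finset ι, ∃ l : ℝ, Tendsto F (𝓝[quadrant τ x r] x) (𝓝 l)) ∧
      ContinuousWithinAt F (quadrant τ x ∅) x

/-- The half-open box `(a, b]`. -/
def box (a b : ι → ℝ) : Set (ι → ℝ) :=
  Set.univ.pi fun j => Set.Ioc (a j) (b j)

/-- The generalized difference of `G` over the `2 ^ |ι|` corners of the box `(a, b]`. -/
def increment (G : (ι → ℝ) → ℝ) (a b : ι → ℝ) : ℝ :=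
  ∑ t : Finset ι, (-1 : ℝ) ^ t.card * G (fun j => if j ∈ t then a j else b j)

/-- The variation of `G` on `(0, τ]` in the sense of Vitali: the supremum, over the grids of
`(0, τ]`, of the sum of the absolute increments of `G` over the cells of the grid. -/
def vitaliVariation (τ : ι → ℝ) (G : (ι → ℝ) → ℝ) : ℝ≥0∞ :=
  ⨆ (n : ℕ) (g : ι → ℕ → ℝ) (_ : ∀ j, Monotone (g j) ∧ ∀ k, g j k ∈ Set.Icc 0 (τ j)),
    ∑ k : ι → Fin n,
      ENNReal.ofReal |increment G (fun j => g j (k j)) (fun j => g j (k j + 1))|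

/-- `μ` is the signed measure on `(0, τ]` generated by `G`: it gives each box `(a, b]` in the cube
the generalized difference of `G`. -/
def IsGeneratedBy (τ : ι → ℝ) (G : (ι → ℝ) → ℝ) (μ : SignedMeasure (ι → ℝ)) : Prop :=
  (∀ a b : ι → ℝ, 0 ≤ a → a ≤ b → b ≤ τ → μ (box a b) = increment G a b) ∧
    ∀ A : Set (ι → ℝ), Disjoint A (box 0 τ) → μ A = 0

open Classical in
/-- The signed measure on `(0, τ]` generated by `G` (zero if there is none). -/
def generatedMeasure (τ : ι → ℝ) (G : (ι → ℝ) → ℝ) : SignedMeasure (ι → ℝ) :=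
  if h : ∃ μ, IsGeneratedBy τ G μ then h.choose else 0

/-- `ν` is the signed measure on the closed cube `[0, τ]` with distribution function `Z`. As for
the cumulative distribution function of a probability law on the cube, `Z` counts as zero below
the cube, so that the lower faces of the cube may carry mass. -/
def HasDistribution (τ : ι → ℝ) (Z : (ι → ℝ) → ℝ) (ν : SignedMeasure (ι → ℝ)) : Prop :=
  (∀ x ∈ Set.Icc 0 τ, ν (Set.Icc 0 x) = Z x) ∧
    ∀ A : Set (ι → ℝ), Disjoint A (Set.Icc 0 τ) → ν A = 0

open Classical in
/-- The signed measure `dZ` on `[0, τ]` (zero if there is none). -/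
def cubeMeasure (τ : ι → ℝ) (Z : (ι → ℝ) → ℝ) : SignedMeasure (ι → ℝ) :=
  if h : ∃ ν, HasDistribution τ Z ν then h.choose else 0

/-- `Z̄(u) = dZ([u, τ])`. -/
def upper (τ : ι → ℝ) (Z : (ι → ℝ) → ℝ) (u : ι → ℝ) : ℝ :=
  cubeMeasure τ Z (Set.Icc u τ)

/-- The supremum norm over the cube `[0, τ]`. -/
def supNorm (τ : ι → ℝ) (f : (ι → ℝ) → ℝ) : ℝ :=
  ⨆ x : Set.Icc (0 : ι → ℝ) τ, |f x|

/-- The point `(u_s, 0_{-s})`. -/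
def zeroExtend (s : Finset ι) (u : s → ℝ) : ι → ℝ :=
  fun j => if h : j ∈ s then u ⟨j, h⟩ else 0

/-- The restriction `τ_s` of `τ` to the coordinates in `s`. -/
def corner (τ : ι → ℝ) (s : Finset ι) : s → ℝ := fun j => τ j

/-- The section `F_s(u_s) = F(u_s, 0_{-s})`. -/
def sect (F : (ι → ℝ) → ℝ) (s : Finset ι) (u : s → ℝ) : ℝ := F (zeroExtend s u)

/-- The signed measure `dF_s` on `(0_s, τ_s]`. -/
def sectMeasure (τ : ι → ℝ) (F : (ι → ℝ) → ℝ) (s : Finset ι) : SignedMeasure (s → ℝ) :=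
  generatedMeasure (corner τ s) (sect F s)

/-- The nonempty sets of coordinates (the empty section is the separate term `F(0)`). -/
def sections (ι : Type*) [Fintype ι] [DecidableEq ι] : Finset (Finset ι) :=
  Finset.univ.filter fun s => s.Nonempty

/-- The sectional variation norm on `[0, τ]`. -/
def sectionalVariationNorm (τ : ι → ℝ) (F : (ι → ℝ) → ℝ) : ℝ≥0∞ :=
  ENNReal.ofReal |F 0| + ∑ s ∈ sections ι, vitaliVariation (corner τ s) (sect F s)

end Sectional

end

/-!
Discretising `F_s` on a fine grid gives purely atomic measures whose positive and negative masses
are bounded by the Vitali variation; weak limits of these two parts, together with right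
continuity, yield the signed measure `dF_s`. Möbius inversion over the sets of coordinates
turns the increments of the sections into
`F(x) = F(0) + ∑ s, dF_s((0_s, x_s])`.
Applied to `Z` this exhibits `dZ` as a sum of measures on the faces of the cube through the origin;
integrated against `dZ` it gives the integration by parts formula, since Fubini's theorem exchanges
the two measures of the set of pairs `(x, u)` with `0_s < u ≤ x_s`.
-/

namespace Sectional

/-! ### Generalized differences -/

theorem sum_powerset_sum_powerset_neg_one_pow_mul_sdiff {α R : Type*} [DecidableEq α] [Ring R]
    (S : Finset α) (h : Finset α → R) :
    ∑ s ∈ S.powerset, ∑ t ∈ s.powerset, (-1) ^ t.card * h (s \ t) = h S := by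
  induction S using Finset.induction generalizing h with
  | empty => simp
  | insert a S ha ih =>
    rw [Finset.sum_powerset_insert ha, ← Finset.sum_add_distrib, ← ih fun r => h (insert a r)]
    refine Finset.sum_congr rfl fun s hs => ?_
    have has : a ∉ s := fun h => ha (Finset.mem_powerset.1 hs h)
    have h_erase : ∑ t ∈ s.powerset, (-1) ^ (insert a t).card * h (insert a s \ insert a t) =
        -∑ t ∈ s.powerset, (-1) ^ t.card * h (s \ t) := by
      rw [← Finset.sum_neg_distrib]
      refine Finset.sum_congr rfl fun t ht => ?_
      have hat : a ∉ t := fun h => has (Finset.mem_powerset.1 ht h)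
      rw [Finset.card_insert_of_notMem hat, Finset.insert_sdiff_insert,
        Finset.sdiff_insert_of_notMem has, pow_succ, mul_neg_one, neg_mul]
    rw [Finset.sum_powerset_insert has, h_erase, add_comm _ (-_), add_neg_cancel_left]
    refine Finset.sum_congr rfl fun t ht => ?_
    rw [Finset.insert_sdiff_of_notMem _ fun h => has (Finset.mem_powerset.1 ht h)]

section Increment

variable {ι : Type*} [Fintype ι]

/-- The linear functional on polynomials taking the monomial `∏ j, X j ^ m j` to `G` at the point
of the grid `g` with index `m`. It turns the generalized differences of `G` over boxes of the grid
into products of differences of powers. -/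
noncomputable def gridFunctional (G : (ι → ℝ) → ℝ) (g : ι → ℕ → ℝ) : MvPolynomial ι ℝ →ₗ[ℝ] ℝ :=
  (MvPolynomial.basisMonomials ι ℝ).constr ℝ fun m => G fun j => g j (m j)

theorem gridFunctional_prod_X_pow (G : (ι → ℝ) → ℝ) (g : ι → ℕ → ℝ) (m : ι → ℕ) :
    gridFunctional G g (∏ j, MvPolynomial.X j ^ m j) = G fun j => g j (m j) := by
  rw [MvPolynomial.prod_X_pow, ← congrFun (MvPolynomial.coe_basisMonomials ι ℝ), gridFunctional,
    Module.Basis.constr_basis]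
  exact congrArg G (funext fun j => congrArg (g j) (Finsupp.indicator_of_mem (Finset.mem_univ j) _))

variable [DecidableEq ι]

theorem gridFunctional_prod_X_pow_sub (G : (ι → ℝ) → ℝ) (g : ι → ℕ → ℝ) (p q : ι → ℕ) :
    gridFunctional G g (∏ j, (MvPolynomial.X j ^ q j - MvPolynomial.X j ^ p j)) =
      increment G (fun j => g j (p j)) (fun j => g j (q j)) := by
  rw [Finset.prod_sub, Finset.powerset_univ, map_sum, increment]
  refine Finset.sum_congr rfl fun t _ => ?_
  have h_corner :
      (∏ j ∈ Finset.univ \ t, MvPolynomial.X j ^ q j) * ∏ j ∈ t, MvPolynomial.X j ^ p j =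
        ∏ j, (MvPolynomial.X j ^ (if j ∈ t then p j else q j) : MvPolynomial ι ℝ) := by
    rw [← Finset.prod_sdiff (Finset.subset_univ t)]
    refine congrArg₂ _ (Finset.prod_congr rfl fun j hj => ?_) (Finset.prod_congr rfl fun j hj => ?_)
    · rw [if_neg (Finset.mem_sdiff.1 hj).2]
    · rw [if_pos hj]
  have h_sign : ((-1) ^ t.card : MvPolynomial ι ℝ) = MvPolynomial.C ((-1) ^ t.card) := by simp
  rw [mul_assoc, h_corner, h_sign, MvPolynomial.C_mul', map_smul, gridFunctional_prod_X_pow,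
    smul_eq_mul]
  simp only [apply_ite (g _)]

theorem sum_increment_Ico (G : (ι → ℝ) → ℝ) (g : ι → ℕ → ℝ) {p q : ι → ℕ} (hpq : p ≤ q) :
    ∑ k ∈ Fintype.piFinset fun j => Finset.Ico (p j) (q j),
        increment G (fun j => g j (k j)) (fun j => g j (k j + 1)) =
      increment G (fun j => g j (p j)) (fun j => g j (q j)) := by
  have h_telescope (j : ι) : (MvPolynomial.X j ^ q j - MvPolynomial.X j ^ p j : MvPolynomial ι ℝ) =
      ∑ k ∈ Finset.Ico (p j) (q j), (MvPolynomial.X j ^ (k + 1) - MvPolynomial.X j ^ k) :=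
    (Finset.sum_Ico_sub (fun k => MvPolynomial.X j ^ k) (hpq j)).symm
  simp_rw [← gridFunctional_prod_X_pow_sub G g p q, h_telescope, Finset.prod_univ_sum, map_sum]
  exact Finset.sum_congr rfl fun k _ =>
    (gridFunctional_prod_X_pow_sub G g k fun j => k j + 1).symm

end Increment

theorem increment_sect_zero_corner {ι : Type*} [DecidableEq ι] (F : (ι → ℝ) → ℝ) (x : ι → ℝ)
    (s : Finset ι) :
    increment (sect F s) 0 (corner x s) =
      ∑ t ∈ s.powerset, (-1 : ℝ) ^ t.card * F (fun j => if j ∈ s \ t then x j else 0) := by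
  have h_powerset : s.powerset =
      Finset.univ.map (Finset.mapEmbedding (Function.Embedding.subtype (· ∈ s))).toEmbedding := by
    ext t
    simp only [Finset.mem_powerset, Finset.mem_map, Finset.mem_univ, true_and]
    refine ⟨fun ht => ⟨t.subtype (· ∈ s), Finset.subtype_map_of_mem ht⟩, ?_⟩
    rintro ⟨u, rfl⟩
    exact Finset.map_subtype_subset u
  rw [increment, h_powerset, Finset.sum_map]
  refine Finset.sum_congr rfl fun t _ => ?_
  rw [RelEmbedding.coe_toEmbedding, Finset.mapEmbedding_apply, Finset.card_map, sect]
  congr 2 with j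
  by_cases hj : j ∈ s <;> simp [zeroExtend, corner, hj, ite_not]

theorem eq_add_sum_increment_sect {ι : Type*} [Fintype ι] [DecidableEq ι] (F : (ι → ℝ) → ℝ)
    (x : ι → ℝ) :
    F x = F 0 + ∑ s ∈ sections ι, increment (sect F s) 0 (corner x s) := by
  have h := sum_powerset_sum_powerset_neg_one_pow_mul_sdiff Finset.univ
    fun r => F fun j => if j ∈ r then x j else 0
  have h_sections : sections ι = Finset.univ.erase ∅ := by
    ext s; simp [sections, Finset.nonempty_iff_ne_empty]
  simp only [← increment_sect_zero_corner, Finset.mem_univ, if_true, Finset.powerset_univ] at h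
  rw [← h, h_sections, ← Finset.add_sum_erase _ _ (Finset.mem_univ ∅), increment_sect_zero_corner]
  simp [Pi.zero_def]

/-! ### Boxes and uniqueness -/

theorem mem_box {ι : Type*} {a b x : ι → ℝ} : x ∈ box a b ↔ ∀ j, a j < x j ∧ x j ≤ b j := by
  simp [box]

theorem measurableSet_box {ι : Type*} [Countable ι] (a b : ι → ℝ) : MeasurableSet (box a b) :=
  MeasurableSet.univ_pi fun _ => measurableSet_Ioc

theorem box_subset_box {ι : Type*} {a b c d : ι → ℝ} (hca : c ≤ a) (hbd : b ≤ d) :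
    box a b ⊆ box c d :=
  Set.pi_mono fun j _ => Set.Ioc_subset_Ioc (hca j) (hbd j)

theorem box_subset_Icc {ι : Type*} (a b : ι → ℝ) : box a b ⊆ Set.Icc a b := fun _ hx =>
  ⟨fun j => (mem_box.1 hx j).1.le, fun j => (mem_box.1 hx j).2⟩

theorem box_eq_empty_of_not_le {ι : Type*} {a b : ι → ℝ} (h : ¬a ≤ b) : box a b = ∅ :=
  Set.eq_empty_of_forall_notMem fun _ hx => h ((box_subset_Icc a b hx).1.trans
    (box_subset_Icc a b hx).2)

theorem Iic_inter_box {ι : Type*} (a b x : ι → ℝ) : Set.Iic x ∩ box a b = box a (x ⊓ b) := by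
  ext y
  simp only [Set.mem_inter_iff, Set.mem_Iic, mem_box, Pi.le_def, Pi.inf_apply, le_inf_iff,
    ← forall_and]
  exact forall_congr' fun j => by tauto

theorem frontier_box_subset {ι : Type*} [Finite ι] (a b : ι → ℝ) :
    frontier (box a b) ⊆ ⋃ j, ({x | x j = a j} ∪ {x | x j = b j}) := by
  intro x hx
  by_contra h_faces
  simp only [Set.mem_iUnion, Set.mem_union, Set.mem_ofPred_eq, not_exists, not_or] at h_faces
  have hx_Icc : x ∈ Set.Icc a b := closure_minimal (box_subset_Icc a b) isClosed_Icc hx.1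
  have h_open : IsOpen (Set.univ.pi fun j => Set.Ioo (a j) (b j)) :=
    isOpen_set_pi Set.finite_univ fun _ _ => isOpen_Ioo
  have h_sub : (Set.univ.pi fun j => Set.Ioo (a j) (b j)) ⊆ box a b :=
    Set.pi_mono fun _ _ => Set.Ioo_subset_Ioc_self
  exact hx.2 (interior_maximal h_sub h_open fun j _ =>
    ⟨(hx_Icc.1 j).lt_of_ne' (h_faces j).1, (hx_Icc.2 j).lt_of_ne (h_faces j).2⟩)

theorem sum_measure_cells_le {ι : Type*} [Fintype ι] [DecidableEq ι] (μ : Measure (ι → ℝ))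
    {a b : ι → ℝ} {n : ℕ} {g : ι → ℕ → ℝ}
    (hg : ∀ j, Monotone (g j) ∧ ∀ k, g j k ∈ Set.Icc (a j) (b j)) :
    ∑ k : ι → Fin n, μ (box (fun j => g j (k j)) (fun j => g j (k j + 1))) ≤ μ (box a b) := by
  rw [← measure_biUnion_finset _ fun _ _ => measurableSet_box _ _]
  · exact measure_mono (Set.iUnion₂_subset fun _ _ =>
      box_subset_box (fun j => ((hg j).2 _).1) fun j => ((hg j).2 _).2)
  · intro k _ l _ hkl
    obtain ⟨j, hj⟩ := Function.ne_iff.1 hkl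
    exact Set.disjoint_univ_pi.2
      ⟨j, (hg j).1.pairwise_disjoint_on_Ioc_succ fun h => hj (Fin.ext h)⟩

theorem vectorMeasure_ext_of_Iic {ι M : Type*} [Finite ι] [AddCommGroup M] [TopologicalSpace M]
    [T2Space M] [ContinuousAdd M] {μ ν : VectorMeasure (ι → ℝ) M}
    (h : ∀ x, μ (Set.Iic x) = ν (Set.Iic x)) : μ = ν := by
  have h_univ : μ Set.univ = ν Set.univ := by
    have h_mono : Monotone fun n : ℕ => Set.Iic fun _ : ι => (n : ℝ) := fun m n hmn =>
      Set.Iic_subset_Iic.2 fun _ => Nat.cast_le.2 hmn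
    have h_union : ⋃ n : ℕ, Set.Iic (fun _ : ι => (n : ℝ)) = Set.univ :=
      Set.eq_univ_of_forall fun x => by
        obtain ⟨C, hC⟩ := Finite.exists_le x
        obtain ⟨n, hn⟩ := exists_nat_ge C
        exact Set.mem_iUnion.2 ⟨n, fun j => (hC j).trans hn⟩
    have h_lim (ρ : VectorMeasure (ι → ℝ) M) :
        Tendsto (fun n : ℕ => ρ (Set.Iic fun _ => (n : ℝ))) atTop (𝓝 (ρ Set.univ)) := by
      rw [← h_union]
      exact VectorMeasure.tendsto_vectorMeasure_iUnion_atTop_nat h_mono fun _ => measurableSet_Iic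
    exact tendsto_nhds_unique (h_lim μ) ((h_lim ν).congr fun n => (h _).symm)
  refine VectorMeasure.ext_of_generateFrom
    (Set.univ.pi '' Set.univ.pi fun _ : ι => Set.range (Set.Iic : ℝ → Set ℝ)) ?_ ?_
    (IsPiSystem.pi fun _ => isPiSystem_Iic) h_univ
  · rintro - ⟨S, hS, rfl⟩
    choose! x hx using fun j => hS j (Set.mem_univ j)
    rw [← funext hx, Set.pi_univ_Iic, h]
  · refine (generateFrom_eq_pi (fun _ => ?_) fun _ => ?_).symm
    · rw [← borel_eq_generateFrom_Iic]
      exact (BorelSpace.measurable_eq (α := ℝ)).symm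
    · refine ⟨fun n => Set.Iic (n : ℝ), fun n => ⟨n, rfl⟩, Set.eq_univ_of_forall fun x => ?_⟩
      exact Set.mem_iUnion.2 (exists_nat_ge x)

theorem apply_inter_of_support {X M : Type*} [MeasurableSpace X] [AddCommMonoid M]
    [TopologicalSpace M] [T2Space M] {μ : VectorMeasure X M} {S A : Set X}
    (hS : MeasurableSet S) (hμ : ∀ A, Disjoint A S → μ A = 0) (hA : MeasurableSet A) :
    μ (A ∩ S) = μ A := by
  rw [← VectorMeasure.of_add_of_sdiff (hA.inter hS) hA Set.inter_subset_left,
    Set.sdiff_self_inter, hμ (A \ S) Set.disjoint_sdiff_left, add_zero]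

theorem vectorMeasure_ext_of_Iic_inter {ι M : Type*} [Finite ι] [AddCommGroup M]
    [TopologicalSpace M] [T2Space M] [ContinuousAdd M] {μ ν : VectorMeasure (ι → ℝ) M}
    {S : Set (ι → ℝ)} (hS : MeasurableSet S) (hμ : ∀ A, Disjoint A S → μ A = 0)
    (hν : ∀ A, Disjoint A S → ν A = 0) (h : ∀ x, μ (Set.Iic x ∩ S) = ν (Set.Iic x ∩ S)) :
    μ = ν :=
  vectorMeasure_ext_of_Iic fun x => by
    rw [← apply_inter_of_support hS hμ measurableSet_Iic, h,
      apply_inter_of_support hS hν measurableSet_Iic]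

theorem IsGeneratedBy.unique {ι : Type*} [Fintype ι] [DecidableEq ι] {τ : ι → ℝ}
    {G : (ι → ℝ) → ℝ} {μ ν : SignedMeasure (ι → ℝ)} (hμ : IsGeneratedBy τ G μ)
    (hν : IsGeneratedBy τ G ν) : μ = ν := by
  refine vectorMeasure_ext_of_Iic_inter (measurableSet_box 0 τ) hμ.2 hν.2 fun x => ?_
  rw [Iic_inter_box]
  by_cases hx : 0 ≤ x ⊓ τ
  · rw [hμ.1 _ _ le_rfl hx inf_le_right, hν.1 _ _ le_rfl hx inf_le_right]
  · rw [box_eq_empty_of_not_le hx, VectorMeasure.empty, VectorMeasure.empty]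

theorem HasDistribution.unique {ι : Type*} [Finite ι] {τ : ι → ℝ} {Z : (ι → ℝ) → ℝ}
    {μ ν : SignedMeasure (ι → ℝ)} (hμ : HasDistribution τ Z μ) (hν : HasDistribution τ Z ν) :
    μ = ν := by
  refine vectorMeasure_ext_of_Iic_inter measurableSet_Icc hμ.2 hν.2 fun x => ?_
  rw [← Set.Ici_inter_Iic, Set.inter_left_comm, Set.Iic_inter_Iic, Set.Ici_inter_Iic]
  by_cases hx : 0 ≤ x ⊓ τ
  · rw [hμ.1 _ ⟨hx, inf_le_right⟩, hν.1 _ ⟨hx, inf_le_right⟩]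
  · rw [Set.Icc_eq_empty hx, VectorMeasure.empty, VectorMeasure.empty]

theorem IsGeneratedBy.vitaliVariation_le_variation {ι : Type*} [Fintype ι] [DecidableEq ι]
    {τ : ι → ℝ} {G : (ι → ℝ) → ℝ} {μ : SignedMeasure (ι → ℝ)} (hμ : IsGeneratedBy τ G μ) :
    vitaliVariation τ G ≤ μ.variation (box 0 τ) := by
  refine iSup_le fun n => iSup_le fun g => iSup_le fun hg => ?_
  refine (Finset.sum_le_sum fun k _ => ?_).trans (sum_measure_cells_le μ.variation (n := n) hg)
  rw [← hμ.1 _ _ (fun j => ((hg j).2 _).1) (fun j => (hg j).1 (Nat.le_succ _))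
    (fun j => ((hg j).2 _).2), ← Real.enorm_eq_ofReal_abs]
  exact VectorMeasure.enorm_measure_le_variation _ _

/-! ### Weak limits of discretisations -/

theorem limsup_measure_le_of_tendsto_of_null_frontier {Ω κ : Type*} [MeasurableSpace Ω]
    [TopologicalSpace Ω] [HasOuterApproxClosed Ω] [OpensMeasurableSpace Ω] {l : Filter κ}
    {μ : FiniteMeasure Ω} {μs : κ → FiniteMeasure Ω} (h : Tendsto μs l (𝓝 μ)) {A : Set Ω}
    (hA : (μ : Measure Ω) (frontier A) = 0) :
    limsup (fun i => (μs i : Measure Ω) A) l ≤ (μ : Measure Ω) A :=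
  calc limsup (fun i => (μs i : Measure Ω) A) l
    _ ≤ limsup (fun i => (μs i : Measure Ω) (closure A)) l :=
      limsup_le_limsup (Eventually.of_forall fun _ => measure_mono subset_closure)
    _ ≤ (μ : Measure Ω) (closure A) :=
      FiniteMeasure.limsup_measure_closed_le_of_tendsto h isClosed_closure
    _ = (μ : Measure Ω) A := measure_closure_of_null_frontier hA

theorem tendsto_measure_of_tendsto_of_null_frontier {Ω κ : Type*} [MeasurableSpace Ω]
    [TopologicalSpace Ω] [HasOuterApproxClosed Ω] [OpensMeasurableSpace Ω] {l : Filter κ}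
    {μ : FiniteMeasure Ω} {μs : κ → FiniteMeasure Ω} (h : Tendsto μs l (𝓝 μ)) {A : Set Ω}
    (hA : MeasurableSet A) (hA_frontier : (μ : Measure Ω) (frontier A) = 0) :
    Tendsto (fun i => (μs i : Measure Ω) A) l (𝓝 ((μ : Measure Ω) A)) := by
  refine (tendsto_iff_ultrafilter _ _ _).2 fun U hU => ?_
  have h_lim (B : Set Ω) : Tendsto (fun i => (μs i : Measure Ω) B) U
      (𝓝 (U.map fun i => (μs i : Measure Ω) B).lim) := Ultrafilter.le_nhds_lim _
  have h_le {B : Set Ω} (hB : (μ : Measure Ω) (frontier B) = 0) :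
      (U.map fun i => (μs i : Measure Ω) B).lim ≤ (μ : Measure Ω) B :=
    (h_lim B).limsup_eq.symm.trans_le
      (limsup_measure_le_of_tendsto_of_null_frontier (h.mono_left hU) hB)
  have h_mass :
      Tendsto (fun i => (μs i : Measure Ω) Set.univ) U (𝓝 ((μ : Measure Ω) Set.univ)) := by
    simpa using ENNReal.tendsto_coe.2 ((FiniteMeasure.continuous_mass.tendsto μ).comp
      (h.mono_left hU))
  have h_sum : (U.map fun i => (μs i : Measure Ω) A).lim +
      (U.map fun i => (μs i : Measure Ω) Aᶜ).lim = (μ : Measure Ω) A + (μ : Measure Ω) Aᶜ := by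
    rw [measure_add_measure_compl hA]
    exact tendsto_nhds_unique ((h_lim A).add (h_lim Aᶜ))
      (h_mass.congr fun i => (measure_add_measure_compl hA).symm)
  have h_ge : (μ : Measure Ω) A ≤ (U.map fun i => (μs i : Measure Ω) A).lim := by
    rw [← ENNReal.add_le_add_iff_right (measure_ne_top (μ : Measure Ω) Aᶜ), ← h_sum]
    exact add_le_add_right (h_le (by rwa [frontier_compl])) _
  rw [← (h_le hA_frontier).antisymm h_ge]
  exact h_lim A

theorem exists_tendsto_finiteMeasure_of_isCompact {Ω κ : Type*} [MeasurableSpace Ω]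
    [TopologicalSpace Ω] [T2Space Ω] [BorelSpace Ω] (U : Ultrafilter κ)
    {μs : κ → FiniteMeasure Ω} {C : ℝ≥0∞} (hC : C ≠ ∞) {K : Set Ω} (hK : IsCompact K)
    (h_mass : ∀ i, (μs i : Measure Ω) Set.univ ≤ C) (h_null : ∀ i, (μs i : Measure Ω) Kᶜ = 0) :
    ∃ μ, Tendsto μs U (𝓝 μ) := by
  have h_mem : ∀ i, μs i ∈ {μ : FiniteMeasure Ω | μ.mass ≤ C.toNNReal ∧ μ Kᶜ = 0} := fun i =>
    ⟨ENNReal.toNNReal_mono hC (h_mass i), (FiniteMeasure.null_iff_toMeasure_null _ _).2 (h_null i)⟩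
  obtain ⟨μ, -, hμ⟩ := (isCompact_setOfPred_finiteMeasure_le_of_isCompact C.toNNReal hK
    ).ultrafilter_le_nhds' (U.map μs) (Ultrafilter.mem_map.2 (Filter.univ_mem' h_mem))
  exact ⟨μ, hμ⟩

section AtomicMeasure

variable {κ X : Type*} [MeasurableSpace X]

/-- The measure with an atom of mass `max (w k) 0` at `x k` for each `k ∈ S`. The signed measure
with masses `w k` is the difference of the atomic measures with weights `w` and `-w`. -/
noncomputable def atomicMeasure (S : Finset κ) (x : κ → X) (w : κ → ℝ) : Measure X :=
  ∑ k ∈ S, ENNReal.ofReal (w k) • Measure.dirac (x k)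

theorem atomicMeasure_apply (S : Finset κ) (x : κ → X) (w : κ → ℝ) {A : Set X}
    (hA : MeasurableSet A) :
    atomicMeasure S x w A = ∑ k ∈ S, A.indicator (fun _ => ENNReal.ofReal (w k)) (x k) := by
  rw [atomicMeasure, Measure.finsetSum_apply]
  refine Finset.sum_congr rfl fun k _ => ?_
  by_cases hk : x k ∈ A <;> simp [Measure.dirac_apply' _ hA, hk]

instance isFiniteMeasure_atomicMeasure (S : Finset κ) (x : κ → X) (w : κ → ℝ) :
    IsFiniteMeasure (atomicMeasure S x w) :=
  ⟨by simp [atomicMeasure_apply, ENNReal.sum_lt_top]⟩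

theorem atomicMeasure_apply_eq_zero (S : Finset κ) {x : κ → X} (w : κ → ℝ) {A : Set X}
    (hA : MeasurableSet A) (hx : ∀ k, x k ∉ A) : atomicMeasure S x w A = 0 := by
  rw [atomicMeasure_apply S x w hA]
  exact Finset.sum_eq_zero fun k _ => Set.indicator_of_notMem (hx k) _

theorem atomicMeasure_univ_add_neg (S : Finset κ) (x : κ → X) (w : κ → ℝ) :
    atomicMeasure S x w Set.univ + atomicMeasure S x (-w) Set.univ =
      ∑ k ∈ S, ENNReal.ofReal |w k| := by
  simp only [atomicMeasure_apply _ _ _ MeasurableSet.univ, Set.indicator_univ,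
    ← Finset.sum_add_distrib, Pi.neg_apply]
  refine Finset.sum_congr rfl fun k _ => ?_
  rcases le_total 0 (w k) with h | h
  · rw [ENNReal.ofReal_of_nonpos (neg_nonpos.2 h), add_zero, abs_of_nonneg h]
  · rw [ENNReal.ofReal_of_nonpos h, zero_add, abs_of_nonpos h]

theorem atomicMeasure_real_sub_neg (S : Finset κ) (x : κ → X) (w : κ → ℝ) {A : Set X}
    (hA : MeasurableSet A) :
    (atomicMeasure S x w).real A - (atomicMeasure S x (-w)).real A =
      ∑ k ∈ S, A.indicator (fun _ => w k) (x k) := by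
  have h_real (v : κ → ℝ) : (atomicMeasure S x v).real A =
      ∑ k ∈ S, A.indicator (fun _ => max (v k) 0) (x k) := by
    rw [Measure.real, atomicMeasure_apply S x v hA, ENNReal.toReal_sum]
    · refine Finset.sum_congr rfl fun k _ => ?_
      by_cases hk : x k ∈ A <;> simp [hk, ENNReal.toReal_ofReal']
    · intro k _
      by_cases hk : x k ∈ A <;> simp [hk]
  rw [h_real, h_real, ← Finset.sum_sub_distrib]
  refine Finset.sum_congr rfl fun k _ => ?_
  by_cases hk : x k ∈ A <;> simp [hk, max_zero_sub_max_neg_zero_eq_self]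

end AtomicMeasure

theorem exists_capped_grid_index {ε T a : ℝ} {N : ℕ} (hε : 0 < ε) (ha : 0 ≤ a)
    (hN : T ≤ N * ε) :
    ∃ p ≤ N, (∀ k < N, min (k * ε) T ≤ a ↔ k < p) ∧
      min (p * ε) T ∈ Set.Icc (min a T) (min a T + ε) := by
  rcases lt_or_ge a T with haT | hTa
  · have h_floor : ⌊a / ε⌋₊ < N := by
      rw [Nat.floor_lt (by positivity), div_lt_iff₀ hε]
      exact haT.trans_le hN
    have h_lt : a < ((⌊a / ε⌋₊ + 1 : ℕ) : ℝ) * ε := by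
      rw [← div_lt_iff₀ hε, Nat.cast_succ]
      exact Nat.lt_floor_add_one _
    have h_le : (⌊a / ε⌋₊ : ℝ) * ε ≤ a := (le_div_iff₀ hε).1 (Nat.floor_le (by positivity))
    refine ⟨⌊a / ε⌋₊ + 1, h_floor, fun k _ => ?_, ?_, ?_⟩
    · rw [min_le_iff, or_iff_left haT.not_ge, ← le_div_iff₀ hε, Nat.lt_succ_iff,
        Nat.le_floor_iff (by positivity)]
    · exact min_le_min_right _ h_lt.le
    · rw [min_eq_left haT.le, Nat.cast_succ, add_one_mul]
      exact (min_le_left _ _).trans (by gcongr)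
  · refine ⟨N, le_rfl, fun k hk => iff_of_true ((min_le_right _ _).trans hTa) hk, ?_⟩
    rw [min_eq_right hN, min_eq_right hTa]
    exact ⟨le_rfl, le_add_of_nonneg_right hε.le⟩

section Grid

variable {ι : Type*} [Fintype ι] [DecidableEq ι]

theorem sum_fin_eq_sum_piFinset_range {M : Type*} [AddCommMonoid M] (n : ℕ) (f : (ι → ℕ) → M) :
    ∑ k : ι → Fin n, f (fun j => k j) =
      ∑ k ∈ Fintype.piFinset (fun _ : ι => Finset.range n), f k := by
  refine Finset.sum_bij (fun k _ j => (k j : ℕ)) (fun k _ => ?_) (fun k _ l _ h => ?_)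
    (fun k hk => ?_) fun k _ => rfl
  · exact Fintype.mem_piFinset.2 fun j => Finset.mem_range.2 (k j).2
  · exact funext fun j => Fin.ext (congrFun h j)
  · exact ⟨fun j => ⟨k j, Finset.mem_range.1 (Fintype.mem_piFinset.1 hk j)⟩,
      Finset.mem_univ _, rfl⟩

theorem sum_abs_increment_le_vitaliVariation {τ : ι → ℝ} (G : (ι → ℝ) → ℝ) (n : ℕ)
    {g : ι → ℕ → ℝ} (hg : ∀ j, Monotone (g j) ∧ ∀ k, g j k ∈ Set.Icc 0 (τ j)) :
    ∑ k ∈ Fintype.piFinset fun _ => Finset.range n,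
        ENNReal.ofReal |increment G (fun j => g j (k j)) (fun j => g j (k j + 1))| ≤
      vitaliVariation τ G := by
  rw [← sum_fin_eq_sum_piFinset_range n fun k =>
    ENNReal.ofReal |increment G (fun j => g j (k j)) (fun j => g j (k j + 1))|]
  exact le_iSup_of_le n (le_iSup_of_le g (le_iSup_of_le hg le_rfl))

theorem sum_indicator_box_increment (G : (ι → ℝ) → ℝ) {g : ι → ℕ → ℝ} {a b : ι → ℝ} {N : ℕ}
    {p q : ι → ℕ} (hpq : p ≤ q) (hqN : ∀ j, q j ≤ N)
    (hp : ∀ j, ∀ k < N, g j k ≤ a j ↔ k < p j) (hq : ∀ j, ∀ k < N, g j k ≤ b j ↔ k < q j) :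
    ∑ k ∈ Fintype.piFinset fun _ => Finset.range N, (box a b).indicator
        (fun _ => increment G (fun j => g j (k j)) (fun j => g j (k j + 1))) (fun j => g j (k j)) =
      increment G (fun j => g j (p j)) (fun j => g j (q j)) := by
  have h_mem {k : ι → ℕ} (hk : ∀ j, k j < N) :
      (fun j => g j (k j)) ∈ box a b ↔ k ∈ Fintype.piFinset fun j => Finset.Ico (p j) (q j) := by
    simp only [mem_box, Fintype.mem_piFinset, Finset.mem_Ico, ← not_le (a := g _ _),
      hp _ _ (hk _), hq _ _ (hk _), not_lt]
  rw [← sum_increment_Ico G g hpq]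
  refine (Finset.sum_subset_zero_on_sdiff (fun k hk => ?_) (fun k hk => ?_) fun k hk => ?_).symm
  · refine Fintype.mem_piFinset.2 fun j => Finset.mem_range.2 ?_
    exact (Finset.mem_Ico.1 (Fintype.mem_piFinset.1 hk j)).2.trans_le (hqN j)
  · obtain ⟨hkN, hk_notMem⟩ := Finset.mem_sdiff.1 hk
    have hkN' (j : ι) : k j < N := Finset.mem_range.1 (Fintype.mem_piFinset.1 hkN j)
    exact Set.indicator_of_notMem (mt (h_mem hkN').1 hk_notMem) _
  · have hkN (j : ι) : k j < N :=
      (Finset.mem_Ico.1 (Fintype.mem_piFinset.1 hk j)).2.trans_le (hqN j)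
    rw [Set.indicator_of_mem ((h_mem hkN).2 hk)]

theorem exists_finiteMeasure_box_sub_eq_increment {τ : ι → ℝ} (hτ : 0 ≤ τ) (G : (ι → ℝ) → ℝ)
    {ε : ℝ} (hε : 0 < ε) :
    ∃ P Q : FiniteMeasure (ι → ℝ),
      (P : Measure (ι → ℝ)) Set.univ + (Q : Measure (ι → ℝ)) Set.univ ≤ vitaliVariation τ G ∧
      (P : Measure (ι → ℝ)) (Set.Icc 0 τ)ᶜ = 0 ∧ (Q : Measure (ι → ℝ)) (Set.Icc 0 τ)ᶜ = 0 ∧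
      ∀ a b, 0 ≤ a → a ≤ b → ∃ u ∈ Set.Icc (a ⊓ τ) τ, ∃ v ∈ Set.Icc (b ⊓ τ) τ,
        (∀ j, u j ≤ (a ⊓ τ) j + ε) ∧ (∀ j, v j ≤ (b ⊓ τ) j + ε) ∧
        (P : Measure (ι → ℝ)).real (box a b) - (Q : Measure (ι → ℝ)).real (box a b) =
          increment G u v := by
  obtain ⟨N, hN⟩ : ∃ N : ℕ, ∀ j, τ j ≤ N * ε := by
    obtain ⟨C, hC⟩ := Finite.exists_le τ
    obtain ⟨N, hN⟩ := exists_nat_ge (C / ε)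
    exact ⟨N, fun j => (hC j).trans ((div_le_iff₀ hε).1 hN)⟩
  let g (j : ι) (k : ℕ) : ℝ := min (k * ε) (τ j)
  have hg (j : ι) : Monotone (g j) ∧ ∀ k, g j k ∈ Set.Icc 0 (τ j) :=
    ⟨fun k l hkl => min_le_min_right _ (by gcongr),
      fun k => ⟨le_min (by positivity) (hτ j), min_le_right _ _⟩⟩
  -- The increment over a cell is placed at its lower corner, so that `(a, b]` collects the cells
  -- with index in `[p, q)`, where `p` and `q` are the first grid indices beyond `a` and `b`.
  let w (k : ι → ℕ) : ℝ := increment G (fun j => g j (k j)) (fun j => g j (k j + 1))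
  let S : Finset (ι → ℕ) := Fintype.piFinset fun _ => Finset.range N
  have h_null (v : (ι → ℕ) → ℝ) : atomicMeasure S (fun k j => g j (k j)) v (Set.Icc 0 τ)ᶜ = 0 :=
    atomicMeasure_apply_eq_zero S v measurableSet_Icc.compl fun k => not_not.2
      ⟨fun j => ((hg j).2 _).1, fun j => ((hg j).2 _).2⟩
  refine ⟨⟨atomicMeasure S (fun k j => g j (k j)) w, inferInstance⟩,
    ⟨atomicMeasure S (fun k j => g j (k j)) (-w), inferInstance⟩,
    (atomicMeasure_univ_add_neg _ _ _).trans_le (sum_abs_increment_le_vitaliVariation G N hg),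
    h_null w, h_null (-w), fun a b ha hab => ?_⟩
  choose p hpN hp hp_mem using fun j => exists_capped_grid_index hε (ha j) (hN j)
  choose q hqN hq hq_mem using fun j => exists_capped_grid_index hε ((ha j).trans (hab j)) (hN j)
  have hpq : p ≤ q := fun j => le_of_not_gt fun h => lt_irrefl _ <|
    (hq j _ (h.trans_le (hpN j))).1 (((hp j _ (h.trans_le (hpN j))).2 h).trans (hab j))
  exact ⟨fun j => g j (p j), ⟨fun j => (hp_mem j).1, fun j => min_le_right _ _⟩,
    fun j => g j (q j), ⟨fun j => (hq_mem j).1, fun j => min_le_right _ _⟩,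
    fun j => (hp_mem j).2, fun j => (hq_mem j).2,
    (atomicMeasure_real_sub_neg S _ w (measurableSet_box a b)).trans
      (sum_indicator_box_increment G hpq hqN hp hq)⟩

end Grid

/-- Continuity from the upper right quadrant at each point of the cube `[0, τ]`, by which the
increments of `G` converge along boxes whose corners decrease. Values outside the cube are
irrelevant. -/
def IsRightContinuous {ι : Type*} (τ : ι → ℝ) (G : (ι → ℝ) → ℝ) : Prop :=
  ∀ x ∈ Set.Icc 0 τ, ContinuousWithinAt G (Set.Icc x τ) x

theorem IsRightContinuous.tendsto_increment {ι κ : Type*} [Fintype ι] [DecidableEq ι]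
    {τ : ι → ℝ} {G : (ι → ℝ) → ℝ} (hG : IsRightContinuous τ G) {a b : ι → ℝ}
    (ha : a ∈ Set.Icc 0 τ) (hb : b ∈ Set.Icc 0 τ) {l : Filter κ} {u v : κ → ι → ℝ}
    (hu : Tendsto u l (𝓝 a)) (hv : Tendsto v l (𝓝 b)) (hu_mem : ∀ᶠ i in l, u i ∈ Set.Icc a τ)
    (hv_mem : ∀ᶠ i in l, v i ∈ Set.Icc b τ) :
    Tendsto (fun i => increment G (u i) (v i)) l (𝓝 (increment G a b)) := by
  refine tendsto_finsetSum _ fun t _ => Tendsto.const_mul _ ?_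
  refine (hG (fun j => if j ∈ t then a j else b j) ?_).tendsto.comp
    (tendsto_nhdsWithin_iff.2 ⟨tendsto_pi_nhds.2 fun j => ?_, ?_⟩)
  · constructor <;> intro j <;> dsimp only <;> split_ifs
    exacts [ha.1 j, hb.1 j, ha.2 j, hb.2 j]
  · by_cases hj : j ∈ t
    · simpa only [hj, if_true] using tendsto_pi_nhds.1 hu j
    · simpa only [hj, if_false] using tendsto_pi_nhds.1 hv j
  · filter_upwards [hu_mem, hv_mem] with i hui hvi
    constructor <;> intro j <;> dsimp only <;> split_ifs
    exacts [hui.1 j, hvi.1 j, hui.2 j, hvi.2 j]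

theorem tendsto_of_le_of_le_add {ι κ : Type*} {l : Filter κ} {ε : κ → ℝ}
    (hε : Tendsto ε l (𝓝 0)) {c : ι → ℝ} {x : κ → ι → ℝ} (h_ge : ∀ i, c ≤ x i)
    (h_le : ∀ i j, x i j ≤ c j + ε i) : Tendsto x l (𝓝 c) :=
  tendsto_pi_nhds.2 fun j => tendsto_of_tendsto_of_tendsto_of_le_of_le tendsto_const_nhds
    (by simpa using hε.const_add (c j)) (fun i => h_ge i j) fun i => h_le i j

theorem exists_finiteMeasure_box_sub_eq_of_null_frontier {ι : Type*} [Fintype ι] [DecidableEq ι]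
    {τ : ι → ℝ} (hτ : 0 ≤ τ) {G : (ι → ℝ) → ℝ} (hG : IsRightContinuous τ G)
    (hV : vitaliVariation τ G ≠ ∞) :
    ∃ P Q : FiniteMeasure (ι → ℝ),
      (P : Measure (ι → ℝ)) Set.univ + (Q : Measure (ι → ℝ)) Set.univ ≤ vitaliVariation τ G ∧
      ∀ a b : ι → ℝ, 0 ≤ a → a ≤ b → (P : Measure (ι → ℝ)) (frontier (box a b)) = 0 →
        (Q : Measure (ι → ℝ)) (frontier (box a b)) = 0 →
        (P : Measure (ι → ℝ)).real (box a b) - (Q : Measure (ι → ℝ)).real (box a b) =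
          increment G (a ⊓ τ) (b ⊓ τ) := by
  choose Ps Qs h_mass hPs_null hQs_null h_box using fun n : ℕ =>
    exists_finiteMeasure_box_sub_eq_increment hτ G (ε := 1 / ((n : ℝ) + 1)) (by positivity)
  obtain ⟨P, hP⟩ := exists_tendsto_finiteMeasure_of_isCompact (hyperfilter ℕ) hV isCompact_Icc
    (fun n => le_self_add.trans (h_mass n)) hPs_null
  obtain ⟨Q, hQ⟩ := exists_tendsto_finiteMeasure_of_isCompact (hyperfilter ℕ) hV isCompact_Icc
    (fun n => le_add_self.trans (h_mass n)) hQs_null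
  refine ⟨P, Q, ?_, fun a b ha hab hP_frontier hQ_frontier => ?_⟩
  · exact le_of_tendsto
      ((tendsto_measure_of_tendsto_of_null_frontier hP MeasurableSet.univ (by simp)).add
        (tendsto_measure_of_tendsto_of_null_frontier hQ MeasurableSet.univ (by simp)))
      (Eventually.of_forall h_mass)
  · choose u hu v hv hu_le hv_le h_eq using fun n => h_box n a b ha hab
    have hε : Tendsto (fun n : ℕ => 1 / ((n : ℝ) + 1)) (hyperfilter ℕ : Filter ℕ) (𝓝 0) :=
      tendsto_one_div_add_atTop_nhds_zero_nat.mono_left Nat.hyperfilter_le_atTop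
    have h_increment := hG.tendsto_increment
      ⟨le_inf ha hτ, inf_le_right⟩ ⟨le_inf (ha.trans hab) hτ, inf_le_right⟩
      (tendsto_of_le_of_le_add hε (fun n => (hu n).1) hu_le)
      (tendsto_of_le_of_le_add hε (fun n => (hv n).1) hv_le)
      (Eventually.of_forall hu) (Eventually.of_forall hv)
    have h_real {R : FiniteMeasure (ι → ℝ)} {Rs : ℕ → FiniteMeasure (ι → ℝ)}
        (hR : Tendsto Rs (hyperfilter ℕ : Filter ℕ) (𝓝 R))
        (hR_frontier : (R : Measure (ι → ℝ)) (frontier (box a b)) = 0) :=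
      (ENNReal.tendsto_toReal (measure_ne_top _ _)).comp
        (tendsto_measure_of_tendsto_of_null_frontier hR (measurableSet_box a b) hR_frontier)
    exact tendsto_nhds_unique ((h_real hP hP_frontier).sub (h_real hQ hQ_frontier))
      (h_increment.congr fun n => (h_eq n).symm)

theorem countable_setOf_frontier_box_ne_zero {ι : Type*} [Finite ι] (μ : Measure (ι → ℝ))
    [SFinite μ] (a b : ι → ℝ) :
    {ε : ℝ | μ (frontier (box (fun j => a j + ε) (fun j => b j + ε))) ≠ 0}.Countable := by
  have h_level (c : ι → ℝ) (j : ι) : {ε : ℝ | 0 < μ {x | x j = c j + ε}}.Countable :=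
    (Measure.countable_meas_level_set_pos (μ := μ) (measurable_pi_apply j)).preimage
      (add_right_injective (c j))
  refine (Set.countable_iUnion fun j => (h_level a j).union (h_level b j)).mono fun ε hε => ?_
  by_contra h_null
  simp only [Set.mem_iUnion, Set.mem_union, Set.mem_ofPred_eq, not_exists, not_or, not_lt,
    nonpos_iff_eq_zero] at h_null
  exact hε (measure_mono_null (frontier_box_subset _ _)
    (measure_iUnion_null fun j => measure_union_null (h_null j).1 (h_null j).2))

theorem frequently_nhdsGT_notMem_of_countable {S : Set ℝ} (hS : S.Countable) (a : ℝ) :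
    ∃ᶠ x in 𝓝[>] a, x ∉ S :=
  (nhdsGT_basis a).frequently_iff.2 fun _ hb =>
    let ⟨x, hxS, hx⟩ := (hS.dense_compl ℝ).exists_between hb
    ⟨x, hx, hxS⟩

theorem eventually_nhdsGT_zero_add_lt_iff (c y : ℝ) : ∀ᶠ ε in 𝓝[>] (0 : ℝ), c + ε < y ↔ c < y := by
  rcases lt_or_ge c y with h | h
  · filter_upwards [Ioo_mem_nhdsGT (sub_pos.2 h)] with ε hε
    exact iff_of_true (lt_sub_iff_add_lt'.1 hε.2) h
  · filter_upwards [self_mem_nhdsWithin] with ε hε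
    exact iff_of_false (h.trans (le_add_of_nonneg_right (le_of_lt hε))).not_gt h.not_gt

theorem tendsto_measureReal_box_add {ι : Type*} [Finite ι] (μ : Measure (ι → ℝ))
    [IsFiniteMeasure μ] (a b : ι → ℝ) :
    Tendsto (fun ε : ℝ => μ.real (box (fun j => a j + ε) (fun j => b j + ε))) (𝓝[>] 0)
      (𝓝 (μ.real (box a b))) := by
  refine (ENNReal.tendsto_toReal (measure_ne_top _ _)).comp ?_
  refine tendsto_measure_of_tendsto_indicator _ (fun ε => measurableSet_box _ _)
    MeasurableSet.univ (measure_ne_top _ _) (Eventually.of_forall fun _ => Set.subset_univ _)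
    fun x => ?_
  filter_upwards [eventually_all.2 fun j => eventually_nhdsGT_zero_add_lt_iff (a j) (x j),
    eventually_all.2 fun j => eventually_nhdsGT_zero_add_lt_iff (b j) (x j)] with ε ha hb
  simp only [mem_box, ← not_lt, ha, hb]

theorem exists_finiteMeasure_box_sub_eq {ι : Type*} [Fintype ι] [DecidableEq ι] {τ : ι → ℝ}
    (hτ : 0 ≤ τ) {G : (ι → ℝ) → ℝ} (hG : IsRightContinuous τ G) (hV : vitaliVariation τ G ≠ ∞) :
    ∃ P Q : FiniteMeasure (ι → ℝ),
      (P : Measure (ι → ℝ)) Set.univ + (Q : Measure (ι → ℝ)) Set.univ ≤ vitaliVariation τ G ∧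
      ∀ a b : ι → ℝ, 0 ≤ a → a ≤ b → b ≤ τ →
        (P : Measure (ι → ℝ)).real (box a b) - (Q : Measure (ι → ℝ)).real (box a b) =
          increment G a b := by
  obtain ⟨P, Q, h_mass, h_box⟩ := exists_finiteMeasure_box_sub_eq_of_null_frontier hτ hG hV
  refine ⟨P, Q, h_mass, fun a b ha hab hbτ => ?_⟩
  have h_tendsto {c : ι → ℝ} (hcτ : c ≤ τ) :
      Tendsto (fun ε : ℝ => (fun j => c j + ε) ⊓ τ) (𝓝[>] 0) (𝓝 c) := by
    have h_cont : Continuous fun ε : ℝ => (fun j => c j + ε) ⊓ τ :=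
      continuous_pi fun j => by simp only [Pi.inf_apply]; fun_prop
    simpa [inf_eq_left.2 hcτ] using (h_cont.tendsto 0).mono_left nhdsWithin_le_nhds
  have h_mem {c : ι → ℝ} (hcτ : c ≤ τ) :
      ∀ᶠ ε in 𝓝[>] (0 : ℝ), (fun j => c j + ε) ⊓ τ ∈ Set.Icc c τ :=
    eventually_nhdsWithin_of_forall fun ε hε =>
      ⟨le_inf (fun j => le_add_of_nonneg_right (le_of_lt hε)) hcτ, inf_le_right⟩
  have haτ : a ≤ τ := hab.trans hbτ
  refine tendsto_nhds_unique_of_frequently_eq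
    ((tendsto_measureReal_box_add _ a b).sub (tendsto_measureReal_box_add _ a b))
    (hG.tendsto_increment ⟨ha, haτ⟩ ⟨ha.trans hab, hbτ⟩ (h_tendsto haτ) (h_tendsto hbτ)
      (h_mem haτ) (h_mem hbτ)) ?_
  -- Only countably many translates of the box charge their frontier, so `h_box` applies to
  -- arbitrarily small translations.
  have h_countable := (countable_setOf_frontier_box_ne_zero (P : Measure (ι → ℝ)) a b).union
    (countable_setOf_frontier_box_ne_zero (Q : Measure (ι → ℝ)) a b)
  refine ((frequently_nhdsGT_notMem_of_countable h_countable 0).and_eventually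
    self_mem_nhdsWithin).mono fun ε ⟨hε_null, hε⟩ => ?_
  simp only [Set.mem_union, Set.mem_ofPred_eq, not_or, not_not] at hε_null
  exact h_box _ _ (fun j => add_nonneg (ha j) (le_of_lt hε)) (fun j => add_le_add_left (hab j) ε)
    hε_null.1 hε_null.2

theorem exists_isGeneratedBy {ι : Type*} [Fintype ι] [DecidableEq ι] {τ : ι → ℝ} (hτ : 0 ≤ τ)
    {G : (ι → ℝ) → ℝ} (hG : IsRightContinuous τ G) (hV : vitaliVariation τ G ≠ ∞) :
    ∃ μ, IsGeneratedBy τ G μ ∧ μ.variation (box 0 τ) ≤ vitaliVariation τ G := by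
  obtain ⟨P, Q, h_mass, h_box⟩ := exists_finiteMeasure_box_sub_eq hτ hG hV
  have h_meas := measurableSet_box (0 : ι → ℝ) τ
  refine ⟨((P : Measure (ι → ℝ)).toSignedMeasure -
    (Q : Measure (ι → ℝ)).toSignedMeasure).restrict (box 0 τ), ⟨fun a b ha hab hb => ?_,
      fun A hA => ?_⟩, ?_⟩
  · rw [VectorMeasure.restrict_apply _ h_meas (measurableSet_box a b),
      Set.inter_eq_left.2 (box_subset_box ha hb),
      Measure.toSignedMeasure_sub_apply (measurableSet_box a b), h_box a b ha hab hb]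
  · by_cases hA_meas : MeasurableSet A
    · rw [VectorMeasure.restrict_apply _ h_meas hA_meas, hA.inter_eq, VectorMeasure.empty]
    · exact VectorMeasure.not_measurable _ hA_meas
  · refine (VectorMeasure.variation_restrict_le _).trans ((Measure.restrict_apply_le _ _).trans ?_)
    refine (VectorMeasure.variation_sub_le _).trans (le_trans ?_ h_mass)
    rw [Measure.variation_toSignedMeasure, Measure.variation_toSignedMeasure, Measure.add_apply]
    gcongr <;> exact Set.subset_univ _

/-! ### Sections and faces -/

theorem corner_nonneg {ι : Type*} {τ : ι → ℝ} (hτ : 0 ≤ τ) (s : Finset ι) : 0 ≤ corner τ s :=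
  fun j => hτ j

theorem continuous_zeroExtend {ι : Type*} [DecidableEq ι] (s : Finset ι) :
    Continuous (zeroExtend s) :=
  continuous_pi fun j => by unfold zeroExtend; split_ifs <;> fun_prop

theorem zeroExtend_le_iff {ι : Type*} [DecidableEq ι] {s : Finset ι} {u : s → ℝ} {x : ι → ℝ}
    (hx : 0 ≤ x) : zeroExtend s u ≤ x ↔ u ≤ corner x s := by
  refine ⟨fun h j => by simpa [zeroExtend, corner] using h j, fun h j => ?_⟩
  by_cases hj : j ∈ s
  · simpa [zeroExtend, corner, hj] using h ⟨j, hj⟩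
  · simpa [zeroExtend, hj] using hx j

theorem zeroExtend_le_zeroExtend {ι : Type*} [DecidableEq ι] {s : Finset ι} {u v : s → ℝ} :
    zeroExtend s u ≤ zeroExtend s v ↔ u ≤ v := by
  refine ⟨fun h j => by simpa [zeroExtend] using h j, fun h j => ?_⟩
  by_cases hj : j ∈ s
  · simpa [zeroExtend, hj] using h ⟨j, hj⟩
  · simp [zeroExtend, hj]

theorem zeroExtend_zero {ι : Type*} [DecidableEq ι] (s : Finset ι) : zeroExtend s 0 = 0 := by
  ext j; simp [zeroExtend]

theorem zeroExtend_nonneg {ι : Type*} [DecidableEq ι] {s : Finset ι} {u : s → ℝ} :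
    0 ≤ zeroExtend s u ↔ 0 ≤ u := by
  rw [← zeroExtend_zero s, zeroExtend_le_zeroExtend]

theorem zeroExtend_mem_Icc {ι : Type*} [DecidableEq ι] {s : Finset ι} {u : s → ℝ} {x : ι → ℝ}
    (hx : 0 ≤ x) : zeroExtend s u ∈ Set.Icc 0 x ↔ u ∈ Set.Icc 0 (corner x s) :=
  and_congr zeroExtend_nonneg (zeroExtend_le_iff hx)

theorem preimage_zeroExtend_Icc_inter_box {ι : Type*} [DecidableEq ι] {τ x : ι → ℝ}
    (hx : x ∈ Set.Icc 0 τ) (s : Finset ι) :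
    zeroExtend s ⁻¹' Set.Icc 0 x ∩ box 0 (corner τ s) = box 0 (corner x s) := by
  ext u
  rw [Set.mem_inter_iff, Set.mem_preimage, zeroExtend_mem_Icc hx.1]
  exact ⟨fun hu => mem_box.2 fun j => ⟨(mem_box.1 hu.2 j).1, hu.1.2 j⟩,
    fun hu => ⟨box_subset_Icc _ _ hu, box_subset_box le_rfl (fun j : s => hx.2 j) hu⟩⟩

theorem IsCadlag.isRightContinuous {ι : Type*} [DecidableEq ι] {τ : ι → ℝ} {F : (ι → ℝ) → ℝ}
    (hF : IsCadlag τ F) : IsRightContinuous τ F := fun x hx =>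
  (hF x hx).2.mono fun _ hy => ⟨⟨hx.1.trans hy.1, hy.2⟩, fun j => by simpa using hy.1 j⟩

theorem IsRightContinuous.sect {ι : Type*} [DecidableEq ι] {τ : ι → ℝ} {F : (ι → ℝ) → ℝ}
    (hτ : 0 ≤ τ) (hF : IsRightContinuous τ F) (s : Finset ι) :
    IsRightContinuous (corner τ s) (sect F s) := fun _ hu =>
  (hF _ ((zeroExtend_mem_Icc hτ).2 hu)).comp (continuous_zeroExtend s).continuousWithinAt
    fun _ hv => ⟨zeroExtend_le_zeroExtend.2 hv.1, (zeroExtend_le_iff hτ).2 hv.2⟩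

section Distribution

variable {ι : Type*} [Fintype ι] [DecidableEq ι] {τ : ι → ℝ} {F : (ι → ℝ) → ℝ}

/-- A right continuous function on the cube `[0, τ]` of finite sectional variation norm: the
functions that are recovered from the measures generated by their sections. -/
structure HasBoundedSectionalVariation (τ : ι → ℝ) (F : (ι → ℝ) → ℝ) : Prop where
  isRightContinuous : IsRightContinuous τ F
  norm_lt_top : sectionalVariationNorm τ F < ∞

/-- The sum of the point mass `F 0` at the origin and of the measures `dF_s` placed on the faces
of the cube `[0, τ]` through the origin. -/
noncomputable def faceMeasure (τ : ι → ℝ) (F : (ι → ℝ) → ℝ) : SignedMeasure (ι → ℝ) :=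
  VectorMeasure.dirac 0 (F 0) + ∑ s ∈ sections ι, (sectMeasure τ F s).map (zeroExtend s)

theorem faceMeasure_apply (τ : ι → ℝ) (F : (ι → ℝ) → ℝ) {A : Set (ι → ℝ)}
    (hA : MeasurableSet A) :
    faceMeasure τ F A = VectorMeasure.dirac 0 (F 0) A +
      ∑ s ∈ sections ι, sectMeasure τ F s (zeroExtend s ⁻¹' A) := by
  rw [faceMeasure, add_apply, sum_apply]
  congr 1
  exact Finset.sum_congr rfl fun s _ =>
    VectorMeasure.map_apply _ (continuous_zeroExtend s).measurable hA

namespace HasBoundedSectionalVariation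

theorem vitaliVariation_sect_ne_top (hF : HasBoundedSectionalVariation τ F) {s : Finset ι}
    (hs : s ∈ sections ι) : vitaliVariation (corner τ s) (sect F s) ≠ ∞ := by
  have h := hF.norm_lt_top
  rw [sectionalVariationNorm, ENNReal.add_lt_top, ENNReal.sum_lt_top] at h
  exact (h.2 s hs).ne

theorem toReal_norm (hF : HasBoundedSectionalVariation τ F) :
    (sectionalVariationNorm τ F).toReal =
      |F 0| + ∑ s ∈ sections ι, (vitaliVariation (corner τ s) (sect F s)).toReal := by
  rw [sectionalVariationNorm, ENNReal.toReal_add ENNReal.ofReal_ne_top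
    (ENNReal.sum_ne_top.2 fun _ => hF.vitaliVariation_sect_ne_top),
    ENNReal.toReal_ofReal (abs_nonneg _),
    ENNReal.toReal_sum fun _ => hF.vitaliVariation_sect_ne_top]

theorem exists_isGeneratedBy_sect (hF : HasBoundedSectionalVariation τ F) (hτ : 0 ≤ τ)
    {s : Finset ι} (hs : s ∈ sections ι) :
    ∃ μ, IsGeneratedBy (corner τ s) (sect F s) μ ∧
      μ.variation (box 0 (corner τ s)) ≤ vitaliVariation (corner τ s) (sect F s) :=
  exists_isGeneratedBy (corner_nonneg hτ s) (hF.isRightContinuous.sect hτ s)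
    (hF.vitaliVariation_sect_ne_top hs)

theorem isGeneratedBy_sectMeasure (hF : HasBoundedSectionalVariation τ F) (hτ : 0 ≤ τ)
    {s : Finset ι} (hs : s ∈ sections ι) :
    IsGeneratedBy (corner τ s) (sect F s) (sectMeasure τ F s) := by
  obtain ⟨μ, hμ, -⟩ := hF.exists_isGeneratedBy_sect hτ hs
  rw [sectMeasure, generatedMeasure, dif_pos ⟨μ, hμ⟩]
  exact Exists.choose_spec (p := IsGeneratedBy (corner τ s) (sect F s)) _

theorem existsUnique_isGeneratedBy_sect (hF : HasBoundedSectionalVariation τ F) (hτ : 0 ≤ τ)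
    {s : Finset ι} (hs : s ∈ sections ι) : ∃! μ, IsGeneratedBy (corner τ s) (sect F s) μ :=
  ⟨_, hF.isGeneratedBy_sectMeasure hτ hs,
    fun _ hμ => hμ.unique (hF.isGeneratedBy_sectMeasure hτ hs)⟩

theorem variation_sectMeasure (hF : HasBoundedSectionalVariation τ F) (hτ : 0 ≤ τ)
    {s : Finset ι} (hs : s ∈ sections ι) :
    (sectMeasure τ F s).variation (box 0 (corner τ s)) =
      vitaliVariation (corner τ s) (sect F s) := by
  refine le_antisymm ?_ (hF.isGeneratedBy_sectMeasure hτ hs).vitaliVariation_le_variation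
  obtain ⟨μ, hμ, h_le⟩ := hF.exists_isGeneratedBy_sect hτ hs
  rwa [(hF.isGeneratedBy_sectMeasure hτ hs).unique hμ]

theorem eq_add_sum_sectMeasure (hF : HasBoundedSectionalVariation τ F) {x : ι → ℝ}
    (hx : x ∈ Set.Icc 0 τ) :
    F x = F 0 + ∑ s ∈ sections ι, sectMeasure τ F s (box 0 (corner x s)) := by
  rw [eq_add_sum_increment_sect F x]
  congr 1
  refine Finset.sum_congr rfl fun s hs => ?_
  rw [(hF.isGeneratedBy_sectMeasure (hx.1.trans hx.2) hs).1 _ _ le_rfl (corner_nonneg hx.1 s)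
    fun j => hx.2 j]

theorem hasDistribution_faceMeasure (hF : HasBoundedSectionalVariation τ F) (hτ : 0 ≤ τ) :
    HasDistribution τ F (faceMeasure τ F) := by
  refine ⟨fun x hx => ?_, fun A hA => ?_⟩
  · rw [faceMeasure_apply _ _ measurableSet_Icc, hF.eq_add_sum_sectMeasure hx,
      VectorMeasure.dirac_apply_of_mem measurableSet_Icc ⟨le_rfl, hx.1⟩]
    congr 1
    refine Finset.sum_congr rfl fun s hs => ?_
    rw [← apply_inter_of_support (measurableSet_box 0 (corner τ s))
      (hF.isGeneratedBy_sectMeasure hτ hs).2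
      ((continuous_zeroExtend s).measurable measurableSet_Icc),
      preimage_zeroExtend_Icc_inter_box hx]
  · by_cases hA_meas : MeasurableSet A
    · rw [faceMeasure_apply _ _ hA_meas, VectorMeasure.dirac_apply_of_notMem
        fun h_zero => hA.notMem_of_mem_left h_zero ⟨le_rfl, hτ⟩, zero_add]
      refine Finset.sum_eq_zero fun s hs => (hF.isGeneratedBy_sectMeasure hτ hs).2 _ ?_
      refine Disjoint.mono_right (fun u hu => ?_) (hA.preimage (zeroExtend s))
      exact (zeroExtend_mem_Icc hτ).2 (box_subset_Icc _ _ hu)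
    · exact VectorMeasure.not_measurable _ hA_meas

theorem hasDistribution_cubeMeasure (hF : HasBoundedSectionalVariation τ F) (hτ : 0 ≤ τ) :
    HasDistribution τ F (cubeMeasure τ F) := by
  rw [cubeMeasure, dif_pos ⟨_, hF.hasDistribution_faceMeasure hτ⟩]
  exact Exists.choose_spec (p := HasDistribution τ F) _

theorem existsUnique_hasDistribution (hF : HasBoundedSectionalVariation τ F) (hτ : 0 ≤ τ) :
    ∃! ν, HasDistribution τ F ν :=
  ⟨_, hF.hasDistribution_cubeMeasure hτ, fun _ hν => hν.unique (hF.hasDistribution_cubeMeasure hτ)⟩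

end HasBoundedSectionalVariation

end Distribution

/-! ### Integration by parts -/

instance isFiniteMeasure_variation {X : Type*} [MeasurableSpace X] (μ : SignedMeasure X) :
    IsFiniteMeasure μ.variation := by
  rw [← SignedMeasure.totalVariation_eq_variation]
  infer_instance

theorem integral_apply_prodMk_left_eq_integral_apply_prodMk_right {X Y E F G : Type*}
    [MeasurableSpace X] [MeasurableSpace Y] [NormedAddCommGroup E] [NormedSpace ℝ E]
    [NormedAddCommGroup F] [NormedSpace ℝ F] [NormedAddCommGroup G] [NormedSpace ℝ G]
    [CompleteSpace G] {μ : VectorMeasure X E} {ν : VectorMeasure Y F}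
    [IsFiniteMeasure μ.variation] [IsFiniteMeasure ν.variation] (B : F →L[ℝ] E →L[ℝ] G)
    {S : Set (X × Y)} (hS : MeasurableSet S) :
    ∫ᵛ x, ν (Prod.mk x ⁻¹' S) ∂[B; μ] = ∫ᵛ y, μ ((fun x => (x, y)) ⁻¹' S) ∂[B.flip; ν] := by
  have h_swap : ν.prod μ B = (μ.prod ν B.flip).map Prod.swap := by
    refine VectorMeasure.prod_eq_of_forall_apply_prod fun s t hs ht => ?_
    rw [VectorMeasure.map_apply _ measurable_swap (hs.prod ht), Set.preimage_swap_prod,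
      VectorMeasure.prod_apply, ContinuousLinearMap.flip_apply]
  calc ∫ᵛ x, ν (Prod.mk x ⁻¹' S) ∂[B; μ]
      = μ.prod ν B.flip S := (VectorMeasure.prod_flip_apply_eq_integral hS).symm
    _ = ν.prod μ B (Prod.swap ⁻¹' S) := by
        rw [h_swap, VectorMeasure.map_apply _ measurable_swap (measurable_swap hS),
          ← Set.preimage_comp, Prod.swap_swap_eq, Set.preimage_id]
    _ = ∫ᵛ y, μ ((fun x => (x, y)) ⁻¹' S) ∂[B.flip; ν] :=
        VectorMeasure.prod_apply_eq_integral (measurable_swap hS)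

/-- The pairs of a point `x ∈ [0, τ]` and a point `u ∈ (0, x_s]`. Its slices turn Fubini's theorem
into the exchange of `dF_s((0, x_s])` and `dZ([u, τ])` under the integral sign. -/
def belowSet {ι : Type*} (τ : ι → ℝ) (s : Finset ι) : Set ((ι → ℝ) × (s → ℝ)) :=
  {p | p.1 ∈ Set.Icc 0 τ ∧ p.2 ∈ box 0 (corner p.1 s)}

theorem measurableSet_belowSet {ι : Type*} [Countable ι] (τ : ι → ℝ) (s : Finset ι) :
    MeasurableSet (belowSet τ s) := by
  have h_below : {p : (ι → ℝ) × (s → ℝ) | p.2 ∈ box 0 (corner p.1 s)} =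
      ⋂ j, {p | 0 < p.2 j} ∩ {p | p.2 j ≤ p.1 j} := by
    ext p
    simp [mem_box, corner]
  refine (measurable_fst measurableSet_Icc).inter ?_
  change MeasurableSet {p : (ι → ℝ) × (s → ℝ) | p.2 ∈ box 0 (corner p.1 s)}
  rw [h_below]
  exact MeasurableSet.iInter fun j => (measurableSet_lt (by fun_prop) (by fun_prop)).inter
    (measurableSet_le (by fun_prop) (by fun_prop))

theorem mem_belowSet_iff {ι : Type*} [DecidableEq ι] {τ : ι → ℝ} {s : Finset ι}
    {x : ι → ℝ} {u : s → ℝ} :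
    (x, u) ∈ belowSet τ s ↔ u ∈ box 0 (corner τ s) ∧ x ∈ Set.Icc (zeroExtend s u) τ := by
  constructor
  · rintro ⟨hx, hu⟩
    exact ⟨box_subset_box le_rfl (fun j : s => hx.2 j) hu,
      (zeroExtend_le_iff hx.1).2 (box_subset_Icc _ _ hu).2, hx.2⟩
  · rintro ⟨hu, hx⟩
    have hx_nonneg : 0 ≤ x := (zeroExtend_nonneg.2 (box_subset_Icc _ _ hu).1).trans hx.1
    exact ⟨⟨hx_nonneg, hx.2⟩, mem_box.2 fun j =>
      ⟨(mem_box.1 hu j).1, (zeroExtend_le_iff hx_nonneg).1 hx.1 j⟩⟩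

theorem apply_preimage_prodMk_left_belowSet {ι : Type*} (τ : ι → ℝ) (s : Finset ι)
    (μ : SignedMeasure (s → ℝ)) :
    (fun x => μ (Prod.mk x ⁻¹' belowSet τ s)) =
      (Set.Icc 0 τ).indicator fun x => μ (box 0 (corner x s)) := by
  ext x
  by_cases hx : x ∈ Set.Icc 0 τ <;> simp [belowSet, hx, -Set.mem_Icc]

theorem apply_preimage_prodMk_right_belowSet {ι : Type*} [DecidableEq ι] (τ : ι → ℝ)
    (s : Finset ι) (ν : SignedMeasure (ι → ℝ)) :
    (fun u => ν ((fun x => (x, u)) ⁻¹' belowSet τ s)) =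
      (box 0 (corner τ s)).indicator fun u => ν (Set.Icc (zeroExtend s u) τ) := by
  ext u
  by_cases hu : u ∈ box 0 (corner τ s) <;> simp [Set.preimage, mem_belowSet_iff, hu, -Set.mem_Icc]

theorem integrableOn_apply_box_corner {ι : Type*} [Finite ι] (τ : ι → ℝ) (s : Finset ι)
    (μ : SignedMeasure (s → ℝ)) (ν : SignedMeasure (ι → ℝ)) :
    ν.IntegrableOn (fun x => μ (box 0 (corner x s))) (Set.Icc 0 τ) := by
  rw [← VectorMeasure.integrable_indicator_iff measurableSet_Icc,
    ← apply_preimage_prodMk_left_belowSet]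
  exact VectorMeasure.integrable_vectorMeasure_prodMk_left (measurableSet_belowSet τ s)

theorem integrableOn_apply_Icc_zeroExtend {ι : Type*} [Finite ι] [DecidableEq ι] (τ : ι → ℝ)
    (s : Finset ι) (μ : SignedMeasure (s → ℝ)) (ν : SignedMeasure (ι → ℝ)) :
    μ.IntegrableOn (fun u => ν (Set.Icc (zeroExtend s u) τ)) (box 0 (corner τ s)) := by
  rw [← VectorMeasure.integrable_indicator_iff (measurableSet_box _ _),
    ← apply_preimage_prodMk_right_belowSet]
  exact VectorMeasure.integrable_vectorMeasure_prodMk_left (s := Prod.swap ⁻¹' belowSet τ s)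
    (measurable_swap (measurableSet_belowSet τ s))

theorem setIntegral_apply_box_corner {ι : Type*} [Finite ι] [DecidableEq ι] (τ : ι → ℝ)
    (s : Finset ι) (μ : SignedMeasure (s → ℝ)) (ν : SignedMeasure (ι → ℝ)) :
    ∫ᵛ x in Set.Icc 0 τ, μ (box 0 (corner x s)) ∂•ν =
      ∫ᵛ u in box 0 (corner τ s), ν (Set.Icc (zeroExtend s u) τ) ∂•μ := by
  have h_flip : (ContinuousLinearMap.lsmul ℝ ℝ : ℝ →L[ℝ] ℝ →L[ℝ] ℝ).flip =
      ContinuousLinearMap.lsmul ℝ ℝ := by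
    ext; simp
  rw [← VectorMeasure.integral_indicator measurableSet_Icc,
    ← VectorMeasure.integral_indicator (measurableSet_box _ _),
    ← apply_preimage_prodMk_left_belowSet, ← apply_preimage_prodMk_right_belowSet,
    integral_apply_prodMk_left_eq_integral_apply_prodMk_right _ (measurableSet_belowSet τ s),
    h_flip]

namespace HasBoundedSectionalVariation

variable {ι : Type*} [Fintype ι] [DecidableEq ι] {τ : ι → ℝ} {F : (ι → ℝ) → ℝ}

theorem integrableOn (hF : HasBoundedSectionalVariation τ F) (ν : SignedMeasure (ι → ℝ)) :
    ν.IntegrableOn F (Set.Icc 0 τ) := by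
  rw [← VectorMeasure.integrable_indicator_iff measurableSet_Icc,
    Set.indicator_congr fun x hx => hF.eq_add_sum_sectMeasure hx,
    VectorMeasure.integrable_indicator_iff measurableSet_Icc]
  exact (integrable_const (F 0)).add
    (integrable_finsetSum _ fun s _ => integrableOn_apply_box_corner τ s _ ν)

theorem setIntegral_eq (hF : HasBoundedSectionalVariation τ F) (ν : SignedMeasure (ι → ℝ)) :
    ∫ᵛ x in Set.Icc 0 τ, F x ∂•ν = F 0 * ν (Set.Icc 0 τ) +
      ∑ s ∈ sections ι, ∫ᵛ u in box 0 (corner τ s), ν (Set.Icc (zeroExtend s u) τ)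
        ∂•(sectMeasure τ F s) := by
  rw [VectorMeasure.setIntegral_congr_fun fun x hx => hF.eq_add_sum_sectMeasure hx,
    VectorMeasure.integral_fun_add (integrable_const (F 0))
      (integrable_finsetSum _ fun s _ => integrableOn_apply_box_corner τ s _ ν),
    VectorMeasure.integral_finsetSum _ fun s _ => integrableOn_apply_box_corner τ s _ ν,
    VectorMeasure.setIntegral_const]
  simp_rw [setIntegral_apply_box_corner]
  rfl

theorem abs_setIntegral_le (hF : HasBoundedSectionalVariation τ F) (hτ : 0 ≤ τ)
    {ν : SignedMeasure (ι → ℝ)} {C : ℝ} (hC : ∀ u ∈ Set.Icc 0 τ, |ν (Set.Icc u τ)| ≤ C) :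
    |∫ᵛ x in Set.Icc 0 τ, F x ∂•ν| ≤ C * (sectionalVariationNorm τ F).toReal := by
  have hC_nonneg : 0 ≤ C := (abs_nonneg _).trans (hC 0 ⟨le_rfl, hτ⟩)
  have h_section (s) (hs : s ∈ sections ι) :
      |∫ᵛ u in box 0 (corner τ s), ν (Set.Icc (zeroExtend s u) τ) ∂•(sectMeasure τ F s)| ≤
        C * (vitaliVariation (corner τ s) (sect F s)).toReal := by
    have h_norm := VectorMeasure.norm_setIntegral_le_of_norm_le_const (μ := sectMeasure τ F s)
      (B := (ContinuousLinearMap.lsmul ℝ ℝ : ℝ →L[ℝ] ℝ →L[ℝ] ℝ)) fun u hu =>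
        hC _ ((zeroExtend_mem_Icc hτ).2 (box_subset_Icc 0 (corner τ s) hu))
    rw [← hF.variation_sectMeasure hτ hs]
    exact h_norm.trans (mul_le_mul_of_nonneg_right
      (mul_le_of_le_one_right hC_nonneg ContinuousLinearMap.opNorm_lsmul_le) measureReal_nonneg)
  rw [hF.setIntegral_eq, hF.toReal_norm, mul_add, Finset.mul_sum]
  refine (abs_add_le _ _).trans (add_le_add ?_ ?_)
  · rw [abs_mul, mul_comm]
    exact mul_le_mul_of_nonneg_right (hC 0 ⟨le_rfl, hτ⟩) (abs_nonneg _)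
  · exact (Finset.abs_sum_le_sum_abs _ _).trans (Finset.sum_le_sum h_section)

end HasBoundedSectionalVariation

theorem bddAbove_range_abs_upper {ι : Type*} (τ : ι → ℝ) (Z : (ι → ℝ) → ℝ) :
    BddAbove (Set.range fun u : Set.Icc (0 : ι → ℝ) τ => |upper τ Z u|) :=
  ⟨VectorMeasure.bound (cubeMeasure τ Z), by
    rintro - ⟨u, rfl⟩
    exact (Real.norm_eq_abs _).symm.trans_le VectorMeasure.norm_apply_le_bound⟩

theorem abs_upper_le_supNorm {ι : Type*} {τ : ι → ℝ} (Z : (ι → ℝ) → ℝ) {u : ι → ℝ}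
    (hu : u ∈ Set.Icc 0 τ) : |upper τ Z u| ≤ supNorm τ (upper τ Z) :=
  le_ciSup (bddAbove_range_abs_upper τ Z) (⟨u, hu⟩ : Set.Icc (0 : ι → ℝ) τ)

end Sectional

open Sectional in
theorem mainTheorem12_general {ι : Type*} [Fintype ι] [DecidableEq ι] {τ : ι → ℝ} (hτ : 0 ≤ τ)
    {F Z : (ι → ℝ) → ℝ} (hF : HasBoundedSectionalVariation τ F)
    (hZ : HasBoundedSectionalVariation τ Z) :
    (∃! ν, HasDistribution τ Z ν) ∧
    (∀ s ∈ sections ι,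
      (∃! μ, IsGeneratedBy (corner τ s) (sect F s) μ) ∧
      (sectMeasure τ F s).variation (box 0 (corner τ s)) =
        vitaliVariation (corner τ s) (sect F s)) ∧
    (cubeMeasure τ Z).IntegrableOn F (Set.Icc 0 τ) ∧
    (∀ s ∈ sections ι,
      (sectMeasure τ F s).IntegrableOn (fun u => upper τ Z (zeroExtend s u))
        (box 0 (corner τ s))) ∧
    ∫ᵛ x in Set.Icc 0 τ, F x ∂•(cubeMeasure τ Z) =
      F 0 * upper τ Z 0 + ∑ s ∈ sections ι,
        ∫ᵛ u in box 0 (corner τ s), upper τ Z (zeroExtend s u) ∂•(sectMeasure τ F s) ∧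
    BddAbove (Set.range fun u : Set.Icc (0 : ι → ℝ) τ => |upper τ Z u|) ∧
    |∫ᵛ x in Set.Icc 0 τ, F x ∂•(cubeMeasure τ Z)| ≤
      supNorm τ (upper τ Z) * (sectionalVariationNorm τ F).toReal :=
  ⟨hZ.existsUnique_hasDistribution hτ,
    fun _ hs => ⟨hF.existsUnique_isGeneratedBy_sect hτ hs, hF.variation_sectMeasure hτ hs⟩,
    hF.integrableOn _,
    fun s _ => integrableOn_apply_Icc_zeroExtend τ s _ _,
    hF.setIntegral_eq _,
    bddAbove_range_abs_upper τ Z,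
    hF.abs_setIntegral_le hτ fun _ hu => abs_upper_le_supNorm Z hu⟩

theorem mainTheorem12 (d : ℕ) (τ : Fin d → ℝ) (hτ : 0 ≤ τ) (F Z : (Fin d → ℝ) → ℝ)
    (hF : Sectional.IsCadlag τ F) (hZ : Sectional.IsCadlag τ Z)
    (hFv : Sectional.sectionalVariationNorm τ F < ∞)
    (hZv : Sectional.sectionalVariationNorm τ Z < ∞) :
    -- the measures `dZ` on `[0, τ]` and `dF_s` on `(0_s, τ_s]` exist and are unique, and the
    -- variation in the sectional variation norm is the total variation of `dF_s`
    (∃! ν, Sectional.HasDistribution τ Z ν) ∧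
    (∀ s ∈ Sectional.sections (Fin d),
      (∃! μ, Sectional.IsGeneratedBy (Sectional.corner τ s) (Sectional.sect F s) μ) ∧
      (Sectional.sectMeasure τ F s).variation (Sectional.box 0 (Sectional.corner τ s)) =
        Sectional.vitaliVariation (Sectional.corner τ s) (Sectional.sect F s)) ∧
    -- the integrals converge absolutely
    (Sectional.cubeMeasure τ Z).IntegrableOn F (Set.Icc 0 τ) ∧
    (∀ s ∈ Sectional.sections (Fin d),
      (Sectional.sectMeasure τ F s).IntegrableOn
        (fun u => Sectional.upper τ Z (Sectional.zeroExtend s u))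
        (Sectional.box 0 (Sectional.corner τ s))) ∧
    -- integration by parts
    ∫ᵛ x in Set.Icc 0 τ, F x ∂•(Sectional.cubeMeasure τ Z) =
      F 0 * Sectional.upper τ Z 0 +
        ∑ s ∈ Sectional.sections (Fin d),
          ∫ᵛ u in Sectional.box 0 (Sectional.corner τ s),
            Sectional.upper τ Z (Sectional.zeroExtend s u) ∂•(Sectional.sectMeasure τ F s) ∧
    -- the bound
    BddAbove (Set.range fun u : Set.Icc (0 : Fin d → ℝ) τ => |Sectional.upper τ Z u|) ∧
    ∫ᵛ x in Set.Icc 0 τ, F x ∂•(Sectional.cubeMeasure τ Z) ≤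
      Sectional.supNorm τ (Sectional.upper τ Z) *
        (Sectional.sectionalVariationNorm τ F).toReal := by
  obtain ⟨hdZ, hdF, h_int, h_int_sect, h_parts, h_bdd, h_le⟩ :=
    mainTheorem12_general hτ ⟨hF.isRightContinuous, hFv⟩ ⟨hZ.isRightContinuous, hZv⟩
  exact ⟨hdZ, hdF, h_int, h_int_sect, h_parts, h_bdd, (le_abs_self _).trans h_le⟩
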